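/- Balls and distances in $\mathbb{R}^2$ are taken with respect to the supremum norm, $\lambda$ is Lebesgue measure and $I^2=[-1/2,1/2]^2$. Let $(l_n)$, $(m_n)$ be sequences of even positive integers with $m_n\mid l_n$, $l_n\mid l_{n+1}$ and $l_n,\,m_n,\,l_n/m_n\to\infty$. Let $(S_n)$ be pairwise disjoint closed axis-parallel squares of side length $l_n$ whose vertices have even integer coordinates, let $(T_{n,i})_{1\le i\le m_n^2}$ be the subdivision of $S_n$ into closed squares of side length $l_n/m_n$, and let $\phi_n$ be the homothety of positive ratio $1/l_n$ mapping $S_n$ onto $I^2$. Let $\rho:I^2\to\mathbb{R}$ be continuous with $8/9\le\rho\le 1$, and let $\mathcal{D}_\rho\subset\mathbb{Z}^2$ be a set such that, for all $n,i$: $\mathcal{D}_\rho\cap T_{n,i}$ has exactly $\left\lfloor\int_{T_{n,i}}\rho\circ\phi_n\,d\lambda\right\rfloor$ points, $T_{n,i}\cap(2\mathbb{Z}\times\mathbb{Z})$, $T_{n,i}\cap(\mathbb{Z}\times2\mathbb{Z})$ and $\partial T_{n,i}\cap\mathbb{Z}^2$ are contained in $\mathcal{D}_\rho$; and such that $\mathbb{Z}^2\setminus\bigcup_n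 S_n\subset\mathcal{D}_\rho$. Let $f:\mathcal{D}_\rho\to\mathbb{Z}^2$ be an $L$-Lipschitz bijection which is $\omega$-co-uniformly continuous, i.e. $f^{-1}(B(f(x),r))\subset B(x,\omega(r))$ for all $x\in\mathcal{D}_\rho$ and $r>0$, where $\omega:(0,\infty)\to(0,\infty)$ is increasing and continuous and $\omega(r)=o(r^2)$ as $r\to\infty$. Put $\mathcal{R}_n=\phi_n(\mathcal{D}_\rho\cap S_n)$, choose $\tilde x_n\in\mathcal{R}_n$, and let $f_n:\mathcal{R}_n\to\frac1{l_n}\mathbb{Z}^2$, $$f_n(x)=\tfrac{1}{l_n}\bigl(f(\phi_n^{-1}(x))-f(\phi_n^{-1}(\tilde x_n))\bigr).$$ Let $\widehat f_n:I^2\to\mathbb{R}^2$ be $L$-Lipschitz extensions of the $f_n$, and let $F:I^2\to\mathbb{R}^2$ be the uniform limit of some subsequence of $(\widehat f_n)$. Let $W\subset F(I^2)$ be an open set for which there are finitely many pairwise disjoint open sets $V_1,\dots,V_N\subset I^2$ with $F^{-1}(W)=\bigcup_{i=1}^N V_i$ such that each $F|_{V_i}:V_i\to W$ is a bi-Lipschitz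 bijection. Let $\mathcal{Q}\subset W$ be a closed ball of positive radius centred at a point of $\frac{1}{l_m}\mathbb{Z}^2$ for some index $m$. Then $$F_{\#}(\rho\lambda)|_{\mathcal{Q}}=\lambda|_{\mathcal{Q}},$$ where $\rho\lambda(A)=\int_A\rho\,d\lambda$ for measurable $A\subset I^2$ and $F_\#(\rho\lambda)(B)=\rho\lambda(F^{-1}(B))$. -/

import Mathlib

open Set Filter Topology MeasureTheory
open scoped NNReal

noncomputable section

namespace DeloneRenorm

/-- The plane. Its norm is the supremum norm, so `Metric.ball` and `Metric.closedBall` are squares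
with sides parallel to the axes, and `volume` is Lebesgue measure. -/
abbrev Plane : Type := Fin 2 → ℝ

/-- The unit square `I² = [-1/2, 1/2]²`. -/
def unitSquare : Set Plane := Icc (fun _ => -(1 / 2 : ℝ)) (fun _ => (1 / 2 : ℝ))

/-- The standard lattice `ℤ²` inside the plane. -/
def lattice : Set Plane := {x | ∀ c, ∃ k : ℤ, x c = k}

/-- The scaled lattice `(1/l)ℤ²`. -/
def scaledLattice (l : ℕ) : Set Plane := (fun x : Plane => (1 / (l : ℝ)) • x) '' lattice

/-- The set `2ℤ × ℤ`. -/
def evenFirst : Set Plane := {x | x ∈ lattice ∧ ∃ k : ℤ, x 0 = 2 * k}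

/-- The set `ℤ × 2ℤ`. -/
def evenSecond : Set Plane := {x | x ∈ lattice ∧ ∃ k : ℤ, x 1 = 2 * k}

/-- The closed axis-parallel square with lower left vertex `s` and side length `l`. -/
def bigSquare (s : Fin 2 → ℤ) (l : ℕ) : Set Plane :=
  Icc (fun c => (s c : ℝ)) (fun c => (s c : ℝ) + l)

/-- The `i`-th closed square of the subdivision of `bigSquare s l` into `m²` squares of side
length `l / m`. -/
def smallSquare (s : Fin 2 → ℤ) (l m : ℕ) (i : Fin 2 → Fin m) : Set Plane :=
  Icc (fun c => (s c : ℝ) + ((i c : ℕ) : ℝ) * ((l : ℝ) / m))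
    (fun c => (s c : ℝ) + (((i c : ℕ) : ℝ) + 1) * ((l : ℝ) / m))

/-- The homothety `φ` that sends `bigSquare s l` onto the unit square. -/
def chart (s : Fin 2 → ℤ) (l : ℕ) (x : Plane) : Plane :=
  fun c => (x c - (s c : ℝ)) / l - 1 / 2

/-- The inverse homothety `φ⁻¹`. -/
def chartInv (s : Fin 2 → ℤ) (l : ℕ) (x : Plane) : Plane :=
  fun c => (s c : ℝ) + l * (x c + 1 / 2)

theorem chartInv_chart (s : Fin 2 → ℤ) {l : ℕ} (hl : 0 < l) (x : Plane) :
    chartInv s l (chart s l x) = x := by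
  have h : (l : ℝ) ≠ 0 := by exact_mod_cast hl.ne'
  funext c
  simp only [chartInv, chart]
  field_simp
  ring

theorem chart_chartInv (s : Fin 2 → ℤ) {l : ℕ} (hl : 0 < l) (x : Plane) :
    chart s l (chartInv s l x) = x := by
  have h : (l : ℝ) ≠ 0 := by exact_mod_cast hl.ne'
  funext c
  simp only [chartInv, chart]
  field_simp
  ring

/-- The sequences `l n`, `m n` and the squares `S n = bigSquare (s n) (l n)` used in the
construction of the Delone set. -/
structure IsSquareSystem (l m : ℕ → ℕ) (s : ℕ → Fin 2 → ℤ) : Prop where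
  l_pos : ∀ n, 0 < l n
  m_pos : ∀ n, 0 < m n
  l_even : ∀ n, Even (l n)
  m_even : ∀ n, Even (m n)
  m_dvd_l : ∀ n, m n ∣ l n
  l_tendsto : Tendsto l atTop atTop
  m_tendsto : Tendsto m atTop atTop
  ratio_tendsto : Tendsto (fun n => (l n : ℝ) / m n) atTop atTop
  l_dvd_succ : ∀ n, l n ∣ l (n + 1)
  vertex_even : ∀ n c, Even (s n c)
  disjoint : Pairwise fun n n' => Disjoint (bigSquare (s n) (l n)) (bigSquare (s n') (l n'))

/-- `D` is a Delone set `D_ρ` built from the density `ρ` on the unit square: each small square `T`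
carries `⌊∫_T ρ ∘ φ⌋` points of `D`, satisfies the `2ℤ²`-property and has all the integer points of
its boundary in `D`; outside the big squares every integer point belongs to `D`. -/
structure IsDensitySet (l m : ℕ → ℕ) (s : ℕ → Fin 2 → ℤ) (ρ : Plane → ℝ) (D : Set Plane) :
    Prop where
  subset_lattice : D ⊆ lattice
  card_eq : ∀ n (i : Fin 2 → Fin (m n)),
    (D ∩ smallSquare (s n) (l n) (m n) i).ncard =
      ⌊∫ x in smallSquare (s n) (l n) (m n) i, ρ (chart (s n) (l n) x)⌋₊
  evenFirst_subset : ∀ n (i : Fin 2 → Fin (m n)),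
    smallSquare (s n) (l n) (m n) i ∩ evenFirst ⊆ D
  evenSecond_subset : ∀ n (i : Fin 2 → Fin (m n)),
    smallSquare (s n) (l n) (m n) i ∩ evenSecond ⊆ D
  boundary_subset : ∀ n (i : Fin 2 → Fin (m n)),
    frontier (smallSquare (s n) (l n) (m n) i) ∩ lattice ⊆ D
  outside_subset : lattice \ ⋃ n, bigSquare (s n) (l n) ⊆ D

/-- `ω : (0,∞) → (0,∞)` is increasing and continuous. -/
structure IsModulus (ω : ℝ → ℝ) : Prop where
  pos : ∀ r, 0 < r → 0 < ω r
  mono : MonotoneOn ω (Ioi 0)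
  cont : ContinuousOn ω (Ioi 0)

/-- The map `f`, considered on `D`, is `ω`-co-uniformly continuous:
`f⁻¹(B(f x, r)) ⊆ B(x, ω r)` for all `x ∈ D` and `r > 0`. -/
def IsCoUniform (ω : ℝ → ℝ) (D : Set Plane) (f : Plane → Plane) : Prop :=
  ∀ x ∈ D, ∀ r, 0 < r → D ∩ f ⁻¹' Metric.ball (f x) r ⊆ Metric.ball x (ω r)

/-- The rescaled set `R = φ(D ∩ S)`, where `S = bigSquare s l`. -/
def rescaledSet (s : Fin 2 → ℤ) (l : ℕ) (D : Set Plane) : Set Plane :=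
  chart s l '' (D ∩ bigSquare s l)

/-- The normalization `x ↦ (f (φ⁻¹ x) - f (φ⁻¹ x₀)) / l` of `f` with base point `x₀`. -/
def normalizedMap (s : Fin 2 → ℤ) (l : ℕ) (f : Plane → Plane) (x₀ x : Plane) : Plane :=
  (1 / (l : ℝ)) • (f (chartInv s l x) - f (chartInv s l x₀))

/-- `F` is a renormalized limit of the `L`-Lipschitz map `f` on `D`: for some base points
`x₀ n ∈ R n` and some `L`-Lipschitz extensions `fhat n : I² → ℝ²` of the normalizations
`f n : R n → (1 / l n)ℤ²`, a subsequence of `fhat` converges to `F` uniformly on `I²`. -/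
def IsRenormalizedLimit (l : ℕ → ℕ) (s : ℕ → Fin 2 → ℤ) (D : Set Plane) (f : Plane → Plane)
    (L : ℝ≥0) (F : Plane → Plane) : Prop :=
  ∃ (x₀ : ℕ → Plane) (fhat : ℕ → Plane → Plane) (σ : ℕ → ℕ),
    (∀ n, x₀ n ∈ rescaledSet (s n) (l n) D) ∧
    (∀ n, LipschitzOnWith L (fhat n) unitSquare) ∧
    (∀ n, EqOn (fhat n) (normalizedMap (s n) (l n) f (x₀ n)) (rescaledSet (s n) (l n) D)) ∧
    StrictMono σ ∧
    TendstoUniformlyOn (fun k => fhat (σ k)) F atTop unitSquare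

/-- On the set `V`, the map `F` is `(b, C)`-bi-Lipschitz. -/
def IsBiLipschitzOn (b C : ℝ) (F : Plane → Plane) (V : Set Plane) : Prop :=
  ∀ x ∈ V, ∀ y ∈ V, b * dist x y ≤ dist (F x) (F y) ∧ dist (F x) (F y) ≤ C * dist x y

/-- Over the open set `W ⊆ F(I²)`, the map `F : I² → ℝ²` decomposes into finitely many bi-Lipschitz
pieces: `F⁻¹(W)` is the disjoint union of open sets `V 0, …, V (N - 1)` contained in `I²`, each of
which `F` maps bi-Lipschitzly onto `W`. -/
def DecomposesOver (F : Plane → Plane) (W : Set Plane) : Prop :=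
  IsOpen W ∧ W ⊆ F '' unitSquare ∧
    ∃ (N : ℕ) (V : Fin N → Set Plane),
      (∀ i, IsOpen (V i)) ∧ (∀ i, V i ⊆ unitSquare) ∧
      (Pairwise fun i j => Disjoint (V i) (V j)) ∧
      (⋃ i, V i) = unitSquare ∩ F ⁻¹' W ∧
      (∀ i, BijOn F (V i) W) ∧
      ∀ i, ∃ b C : ℝ, 0 < b ∧ 0 < C ∧ IsBiLipschitzOn b C F (V i)

/-- The measure `ρλ` on the unit square. -/
def densityMeasure (ρ : Plane → ℝ) : Measure Plane :=
  (volume.restrict unitSquare).withDensity fun x => ENNReal.ofReal (ρ x)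

end DeloneRenorm

end

namespace DeloneRenorm

/-! Test both measures against continuous `ψ` with compact support in `W`. Write `g_n` for the
normalized map on the rescaled points of `D`, and use `l_n⁻²` as the mass of a point.

On the domain side, each tile holds `∫ρ` points up to an error of the order of its perimeter, which
is negligible against its area because `l/m → ∞`. Since tiles also shrink after rescaling, the
averages of `ψ ∘ F` over the rescaled points tend to `∫ ψ(F) ρ` (`tendsto_sum_densitySet`). Uniform
convergence allows `F` to be replaced by `g_n` in these averages.

On the target side, `g_n` is injective with values in `(1/l_n)ℤ²`. For large `n` along the
subsequence it also reaches every point of that lattice where `ψ` is nonzero. Indeed such a point is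
`F q`, with `q` at a uniform distance from the boundary of the unit square. Since `f` is onto `ℤ²`,
the point has a preimage in `D`, and since `f⁻¹` is Lipschitz (`IsCoUniform.dist_le`), the rescaled
preimage is close to `q`, hence in the square (`dist_chart_le_of_normalized_eq`). So the average
equals the Riemann sum of `ψ` over `(1/l_n)ℤ²`, which tends to `∫ ψ`. -/

/-! ### Lipschitz inverse of `f` -/

/-- The inclusion of `ℤ²` into the plane. -/
def toPlane (z : Fin 2 → ℤ) : Plane := fun c => (z c : ℝ)

theorem toPlane_injective : Function.Injective toPlane := fun z w h => by
  funext c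
  have := congrFun h c
  simp only [toPlane] at this
  exact_mod_cast this

theorem toPlane_mem_lattice (z : Fin 2 → ℤ) : toPlane z ∈ lattice := fun c => ⟨z c, rfl⟩

theorem exists_toPlane_of_mem_lattice {x : Plane} (hx : x ∈ lattice) : ∃ z, toPlane z = x := by
  choose z hz using hx
  exact ⟨z, funext fun c => (hz c).symm⟩

theorem dist_toPlane_le_one {z w : Fin 2 → ℤ} (h : ∀ c, |z c - w c| ≤ 1) :
    dist (toPlane z) (toPlane w) ≤ 1 := by
  refine (dist_pi_le_iff zero_le_one).2 fun c => ?_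
  rw [Real.dist_eq]
  simp only [toPlane]
  exact_mod_cast h c

/-- A co-uniformly continuous bijection onto `ℤ²` has a Lipschitz inverse, because any two points of
`ℤ²` at distance `n` are joined by a chain of `n` steps of length one. -/
theorem IsCoUniform.dist_le_of_abs_le {ω : ℝ → ℝ} {D : Set Plane}
    {f : Plane → Plane} (hf : IsCoUniform ω D f) (hbij : BijOn f D lattice) (n : ℕ) :
    ∀ z w : Fin 2 → ℤ, (∀ c, |z c - w c| ≤ n) → ∀ x ∈ D, ∀ y ∈ D,
      f x = toPlane z → f y = toPlane w → dist x y ≤ ω 2 * n := by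
  induction n with
  | zero =>
    intro z w h x hx y hy hxz hyw
    have hzw : z = w := by
      funext c
      have := h c
      simp only [Nat.cast_zero, abs_nonpos_iff] at this
      omega
    have : x = y := hbij.injOn hx hy (by rw [hxz, hyw, hzw])
    simp [this]
  | succ n ih =>
    intro z w h x hx y hy hxz hyw
    -- One step towards `w` in every coordinate at once: it has length at most one in the supremum
    -- norm and lowers each nonzero coordinate difference by one.
    set v : Fin 2 → ℤ := fun c => z c + (w c - z c).sign with hv
    have hvz : ∀ c, |v c - z c| ≤ 1 := fun c => by
      simp only [hv, add_sub_cancel_left]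
      rcases lt_trichotomy (w c - z c) 0 with h' | h' | h'
      · simp [Int.sign_eq_neg_one_of_neg h']
      · simp [h']
      · simp [Int.sign_eq_one_of_pos h']
    have hvw : ∀ c, |v c - w c| ≤ n := fun c => by
      have := h c
      push_cast at this
      simp only [hv]
      rw [abs_le] at this ⊢
      rcases lt_trichotomy (w c - z c) 0 with h' | h' | h'
      · rw [Int.sign_eq_neg_one_of_neg h']; omega
      · rw [h', Int.sign_zero]; omega
      · rw [Int.sign_eq_one_of_pos h']; omega
    obtain ⟨u, hu, huv⟩ := hbij.surjOn (toPlane_mem_lattice v)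
    have h1 := ih v w hvw u hu y hy huv hyw
    -- Balls are open, so unit steps need a radius above one; this is why `ω 2` is the constant.
    have h2 : u ∈ Metric.ball x (ω 2) := hf x hx 2 two_pos ⟨hu, by
      rw [mem_preimage, Metric.mem_ball, huv, hxz]
      exact (dist_toPlane_le_one hvz).trans_lt one_lt_two⟩
    have h3 := dist_triangle x u y
    rw [Metric.mem_ball, dist_comm] at h2
    push_cast
    linarith

/-- The chain between the images has as many steps as their distance, which is an integer in the
supremum norm. Taking its floor avoids proving that; coordinate differences, being integers, are
still bounded by the floor. -/
theorem IsCoUniform.dist_le {ω : ℝ → ℝ} (hω : IsModulus ω) {D : Set Plane}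
    {f : Plane → Plane} (hf : IsCoUniform ω D f) (hbij : BijOn f D lattice)
    {x y : Plane} (hx : x ∈ D) (hy : y ∈ D) : dist x y ≤ ω 2 * dist (f x) (f y) := by
  obtain ⟨z, hz⟩ := exists_toPlane_of_mem_lattice (hbij.mapsTo hx)
  obtain ⟨w, hw⟩ := exists_toPlane_of_mem_lattice (hbij.mapsTo hy)
  have hb (c : Fin 2) : |z c - w c| ≤ ⌊dist (f x) (f y)⌋ := by
    rw [Int.le_floor]
    have := dist_le_pi_dist (f x) (f y) c
    rw [Real.dist_eq, ← hz, ← hw] at this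
    simpa [toPlane, ← hz, ← hw] using this
  have h := hf.dist_le_of_abs_le hbij ⌊dist (f x) (f y)⌋.toNat z w (fun c => by
    rw [Int.toNat_of_nonneg (Int.floor_nonneg.2 dist_nonneg)]; exact hb c) x hx y hy hz.symm hw.symm
  refine h.trans (mul_le_mul_of_nonneg_left ?_ (hω.pos 2 two_pos).le)
  have h1 : ((⌊dist (f x) (f y)⌋.toNat : ℤ) : ℝ) = (⌊dist (f x) (f y)⌋ : ℤ) := by
    rw [Int.toNat_of_nonneg (Int.floor_nonneg.2 dist_nonneg)]
  rw [Int.cast_natCast] at h1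
  rw [h1]
  exact Int.floor_le _

/-! ### Integer points of a square and sums over them -/

/-- The half-open axis-parallel square with lower left vertex `u` and side length `a`. -/
def cell (u : Fin 2 → ℤ) (a : ℕ) : Set Plane :=
  Set.pi univ fun c => Ico (u c : ℝ) ((u c : ℝ) + a)

/-- The integer points of `cell u a`. -/
noncomputable def cellPoints (u : Fin 2 → ℤ) (a : ℕ) : Finset (Fin 2 → ℤ) :=
  Fintype.piFinset fun c => Finset.Ico (u c) (u c + a)

theorem mem_cellPoints {u z : Fin 2 → ℤ} {a : ℕ} :
    z ∈ cellPoints u a ↔ ∀ c, u c ≤ z c ∧ z c < u c + a := by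
  simp [cellPoints]

theorem card_cellPoints (u : Fin 2 → ℤ) (a : ℕ) : (cellPoints u a).card = a ^ 2 := by
  simp [cellPoints, Fintype.card_piFinset, sq]

theorem mem_bigSquare {u : Fin 2 → ℤ} {a : ℕ} {x : Plane} :
    x ∈ bigSquare u a ↔ ∀ c, (u c : ℝ) ≤ x c ∧ x c ≤ u c + a := by
  simp only [bigSquare, mem_Icc, Pi.le_def, forall_and]

theorem mem_cell {u : Fin 2 → ℤ} {a : ℕ} {x : Plane} :
    x ∈ cell u a ↔ ∀ c, (u c : ℝ) ≤ x c ∧ x c < u c + a := by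
  simp [cell]

theorem toPlane_mem_cell {u z : Fin 2 → ℤ} {a : ℕ} :
    toPlane z ∈ cell u a ↔ z ∈ cellPoints u a := by
  rw [mem_cell, mem_cellPoints]
  refine forall_congr' fun c => ?_
  simp only [toPlane]
  norm_cast

theorem cell_subset_bigSquare (u : Fin 2 → ℤ) (a : ℕ) : cell u a ⊆ bigSquare u a := fun _ hx =>
  mem_bigSquare.2 fun c => ⟨(mem_cell.1 hx c).1, (mem_cell.1 hx c).2.le⟩

theorem measurableSet_cell (u : Fin 2 → ℤ) (a : ℕ) : MeasurableSet (cell u a) :=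
  MeasurableSet.univ_pi fun _ => measurableSet_Ico

theorem cell_ae_eq_bigSquare (u : Fin 2 → ℤ) (a : ℕ) :
    cell u a =ᵐ[volume] bigSquare u a :=
  Measure.univ_pi_Ico_ae_eq_Icc

theorem isCompact_bigSquare (u : Fin 2 → ℤ) (a : ℕ) : IsCompact (bigSquare u a) := isCompact_Icc

theorem volume_real_bigSquare (u : Fin 2 → ℤ) (a : ℕ) :
    (volume : Measure Plane).real (bigSquare u a) = (a : ℝ) ^ 2 := by
  rw [bigSquare, Measure.real, Real.volume_Icc_pi_toReal]
  · simp [sq]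
  · intro c; simp

/-- A set of integer points has at most `2a + 1` points in a closed square of side `a` that are not
in the half-open square. -/
theorem card_filter_cellPoints_bounds {D : Set Plane} (hD : D ⊆ lattice)
    [DecidablePred fun z => toPlane z ∈ D] (u : Fin 2 → ℤ) (a : ℕ) :
    ((cellPoints u a).filter fun z => toPlane z ∈ D).card ≤ (D ∩ bigSquare u a).ncard ∧
      (D ∩ bigSquare u a).ncard ≤
        ((cellPoints u a).filter fun z => toPlane z ∈ D).card + (2 * a + 1) := by
  have hsq : D ∩ bigSquare u a =
      toPlane '' ((Fintype.piFinset fun c => Finset.Ico (u c) (u c + (a + 1 : ℕ))).filter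
        fun z => toPlane z ∈ D : Finset (Fin 2 → ℤ)) := by
    ext x
    constructor
    · rintro ⟨hx, hxS⟩
      obtain ⟨z, rfl⟩ := exists_toPlane_of_mem_lattice (hD hx)
      refine ⟨z, ?_, rfl⟩
      simp only [Finset.coe_filter, Fintype.mem_piFinset, Finset.mem_Ico, mem_ofPred_eq]
      refine ⟨fun c => ?_, hx⟩
      have := mem_bigSquare.1 hxS c
      simp only [toPlane] at this
      norm_cast at this
      push_cast
      omega
    · rintro ⟨z, hz, rfl⟩
      simp only [Finset.coe_filter, Fintype.mem_piFinset, Finset.mem_Ico, mem_ofPred_eq] at hz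
      refine ⟨hz.2, mem_bigSquare.2 fun c => ?_⟩
      have := hz.1 c
      simp only [toPlane]
      norm_cast
      push_cast at this
      omega
  rw [hsq, ncard_image_of_injective _ toPlane_injective, ncard_coe_finset]
  have hsub : cellPoints u a ⊆ cellPoints u (a + 1) := fun z hz =>
    mem_cellPoints.2 fun c => by
      have := mem_cellPoints.1 hz c
      push_cast
      omega
  refine ⟨Finset.card_le_card (Finset.filter_subset_filter _ hsub), ?_⟩
  calc _ ≤ (((cellPoints u a).filter fun z => toPlane z ∈ D) ∪
        (cellPoints u (a + 1) \ cellPoints u a)).card := by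
        refine Finset.card_le_card fun z hz => ?_
        rw [Finset.mem_filter] at hz
        rw [Finset.mem_union, Finset.mem_filter, Finset.mem_sdiff]
        by_cases h : z ∈ cellPoints u a
        · exact Or.inl ⟨h, hz.2⟩
        · exact Or.inr ⟨hz.1, h⟩
    _ ≤ _ := Finset.card_union_le _ _
    _ = _ := by
        rw [Finset.card_sdiff_of_subset hsub, card_cellPoints, card_cellPoints]
        congr 1
        have : (a + 1) ^ 2 = a ^ 2 + (2 * a + 1) := by ring
        omega

/-- Comparison of a sum over the integer points in a square with an integral, when the number of
points is approximately the integral of the density. -/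
theorem abs_sum_sub_setIntegral_le {u : Fin 2 → ℤ} {a : ℕ} {P : Finset (Fin 2 → ℤ)}
    (hP : P ⊆ cellPoints u a) {H R : Plane → ℝ} {M e b : ℝ}
    (hH : ContinuousOn H (bigSquare u a)) (hR : ContinuousOn R (bigSquare u a))
    (hR0 : ∀ x ∈ bigSquare u a, 0 ≤ R x) (hR1 : ∀ x ∈ bigSquare u a, R x ≤ 1)
    (hM : ∀ x ∈ bigSquare u a, |H x| ≤ M)
    (he : ∀ x ∈ bigSquare u a, ∀ y ∈ bigSquare u a, |H x - H y| ≤ e)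
    (hb : |(P.card : ℝ) - ∫ x in bigSquare u a, R x| ≤ b) :
    |∑ z ∈ P, H (toPlane z) - ∫ x in bigSquare u a, H x * R x| ≤
      2 * e * (a : ℝ) ^ 2 + M * b := by
  have hc : toPlane u ∈ bigSquare u a := mem_bigSquare.2 fun c => by simp [toPlane]
  -- `H` is frozen at the corner. The sum is compared with `P.card * t`, then with `t * ∫ R`, then
  -- with `∫ H * R`; the oscillation `e` is paid twice and the count error `b` once.
  set t := H (toPlane u) with ht
  have he0 : 0 ≤ e := (abs_nonneg _).trans (he _ hc _ hc)
  have hM0 : 0 ≤ M := (abs_nonneg _).trans (hM _ hc)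
  have h1 : |∑ z ∈ P, H (toPlane z) - P.card * t| ≤ e * (a : ℝ) ^ 2 := by
    rw [← nsmul_eq_mul, ← Finset.sum_const, ← Finset.sum_sub_distrib]
    calc _ ≤ ∑ z ∈ P, |H (toPlane z) - t| := Finset.abs_sum_le_sum_abs _ _
      _ ≤ ∑ z ∈ P, e := Finset.sum_le_sum fun z hz =>
          he _ (cell_subset_bigSquare _ _ (toPlane_mem_cell.2 (hP hz))) _ hc
      _ = e * P.card := by rw [Finset.sum_const, nsmul_eq_mul, mul_comm]
      _ ≤ e * (a : ℝ) ^ 2 := by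
          have := Finset.card_le_card hP
          rw [card_cellPoints] at this
          exact mul_le_mul_of_nonneg_left (by exact_mod_cast this) he0
  have hRi : IntegrableOn R (bigSquare u a) := hR.integrableOn_compact (isCompact_bigSquare u a)
  have hHRi : IntegrableOn (fun x => H x * R x) (bigSquare u a) :=
    (hH.mul hR).integrableOn_compact (isCompact_bigSquare u a)
  have h2 : |t * (∫ x in bigSquare u a, R x) - ∫ x in bigSquare u a, H x * R x| ≤
      e * (a : ℝ) ^ 2 := by
    rw [← integral_const_mul, ← integral_sub (hRi.const_mul t) hHRi, ← volume_real_bigSquare u a,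
      ← Real.norm_eq_abs]
    refine norm_setIntegral_le_of_norm_le_const (isCompact_bigSquare u a).measure_lt_top
      fun x hx => ?_
    rw [← sub_mul, Real.norm_eq_abs, abs_mul, abs_of_nonneg (hR0 x hx)]
    calc _ ≤ e * 1 := mul_le_mul (he _ hc _ hx) (hR1 x hx) (hR0 x hx) he0
      _ = e := mul_one e
  have h3 : |P.card * t - t * (∫ x in bigSquare u a, R x)| ≤ M * b := by
    rw [mul_comm, ← mul_sub, abs_mul]
    exact mul_le_mul (hM _ hc) hb (abs_nonneg _) hM0
  have h4 := abs_sub_le (∑ z ∈ P, H (toPlane z)) (P.card * t)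
    (∫ x in bigSquare u a, H x * R x)
  have h5 := abs_sub_le ((P.card : ℝ) * t) (t * (∫ x in bigSquare u a, R x))
    (∫ x in bigSquare u a, H x * R x)
  linarith

/-! ### Subdivision of a big square into tiles -/

/-- The lower left vertex of the `i`-th tile of side `a`. -/
def tileVertex (s : Fin 2 → ℤ) (a : ℕ) {m : ℕ} (i : Fin 2 → Fin m) : Fin 2 → ℤ :=
  fun c => s c + ((i c : ℕ) : ℤ) * a

theorem smallSquare_eq_bigSquare (s : Fin 2 → ℤ) {m : ℕ} (a : ℕ) (hm : 0 < m)
    (i : Fin 2 → Fin m) : smallSquare s (m * a) m i = bigSquare (tileVertex s a i) a := by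
  have h : ((m * a : ℕ) : ℝ) / m = a := by
    have : (m : ℝ) ≠ 0 := by exact_mod_cast hm.ne'
    push_cast
    field_simp
  rw [smallSquare, bigSquare, h]
  congr 1
  · funext c; simp [tileVertex]
  · funext c; simp [tileVertex]; ring

theorem cell_tile_subset (s : Fin 2 → ℤ) (m a : ℕ) (i : Fin 2 → Fin m) :
    bigSquare (tileVertex s a i) a ⊆ bigSquare s (m * a) := fun x hx => by
  rw [mem_bigSquare] at hx ⊢
  intro c
  have h := hx c
  simp only [tileVertex] at h
  push_cast at h ⊢
  have h1 : (((i c : ℕ) : ℝ) + 1) * a ≤ m * a :=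
    mul_le_mul_of_nonneg_right (by exact_mod_cast (i c).2) (Nat.cast_nonneg _)
  have h2 : (0 : ℝ) ≤ ((i c : ℕ) : ℝ) * a := by positivity
  constructor <;> nlinarith

theorem exists_mem_cell_tile {s : Fin 2 → ℤ} {m a : ℕ} (ha : 0 < a) {x : Plane}
    (hx : x ∈ cell s (m * a)) : ∃ i : Fin 2 → Fin m, x ∈ cell (tileVertex s a i) a := by
  have ha' : (0 : ℝ) < a := by exact_mod_cast ha
  rw [mem_cell] at hx
  have h0 (c : Fin 2) : 0 ≤ (x c - s c) / a := div_nonneg (by linarith [(hx c).1]) ha'.le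
  have h1 (c : Fin 2) : ⌊(x c - s c) / a⌋₊ < m := by
    rw [Nat.floor_lt (h0 c), div_lt_iff₀ ha']
    have := (hx c).2
    push_cast at this
    linarith
  refine ⟨fun c => ⟨_, h1 c⟩, mem_cell.2 fun c => ?_⟩
  have h2 := Nat.floor_le (h0 c)
  have h3 := Nat.lt_floor_add_one ((x c - s c) / a)
  rw [le_div_iff₀ ha'] at h2
  rw [div_lt_iff₀ ha'] at h3
  simp only [tileVertex]
  push_cast
  constructor <;> linarith

theorem cell_eq_iUnion (s : Fin 2 → ℤ) {m a : ℕ} (ha : 0 < a) :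
    cell s (m * a) = ⋃ i : Fin 2 → Fin m, cell (tileVertex s a i) a := by
  ext x
  rw [mem_iUnion]
  refine ⟨exists_mem_cell_tile ha, ?_⟩
  rintro ⟨i, hx⟩
  rw [mem_cell] at hx ⊢
  intro c
  have h := hx c
  simp only [tileVertex] at h
  push_cast at h ⊢
  have h1 : (((i c : ℕ) : ℝ) + 1) * a ≤ m * a :=
    mul_le_mul_of_nonneg_right (by exact_mod_cast (i c).2) (Nat.cast_nonneg _)
  have h2 : (0 : ℝ) ≤ ((i c : ℕ) : ℝ) * a := by positivity
  constructor <;> nlinarith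

theorem pairwise_disjoint_cell_tile (s : Fin 2 → ℤ) (m a : ℕ) :
    Pairwise fun i j : Fin 2 → Fin m =>
      Disjoint (cell (tileVertex s a i) a) (cell (tileVertex s a j) a) := by
  intro i j hij
  rw [Set.disjoint_left]
  intro x hi hj
  apply hij
  funext c
  have h1 := mem_cell.1 hi c
  have h2 := mem_cell.1 hj c
  simp only [tileVertex] at h1 h2
  push_cast at h1 h2
  have ha : (0 : ℝ) ≤ a := Nat.cast_nonneg _
  ext
  by_contra hne
  rcases lt_or_gt_of_ne hne with h | h
  · have : (((i c : ℕ) : ℝ) + 1) * a ≤ (j c : ℕ) * a :=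
      mul_le_mul_of_nonneg_right (by exact_mod_cast h) ha
    nlinarith
  · have : (((j c : ℕ) : ℝ) + 1) * a ≤ (i c : ℕ) * a :=
      mul_le_mul_of_nonneg_right (by exact_mod_cast h) ha
    nlinarith

theorem sum_filter_cellPoints_eq (s : Fin 2 → ℤ) {m a : ℕ} (ha : 0 < a) (p : (Fin 2 → ℤ) → Prop)
    [DecidablePred p] (H : (Fin 2 → ℤ) → ℝ) :
    ∑ z ∈ (cellPoints s (m * a)).filter p, H z =
      ∑ i : Fin 2 → Fin m, ∑ z ∈ (cellPoints (tileVertex s a i) a).filter p, H z := by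
  classical
  rw [← Finset.sum_biUnion]
  · congr 1
    ext z
    simp only [Finset.mem_filter, Finset.mem_biUnion, Finset.mem_univ, true_and,
      ← toPlane_mem_cell, cell_eq_iUnion s ha, mem_iUnion, exists_and_right]
  · intro i _ j _ hij
    rw [Function.onFun, Finset.disjoint_left]
    intro z hi hj
    rw [Finset.mem_filter, ← toPlane_mem_cell] at hi hj
    exact Set.disjoint_left.1 (pairwise_disjoint_cell_tile s m a hij) hi.1 hj.1

theorem setIntegral_bigSquare_eq_sum (s : Fin 2 → ℤ) {m a : ℕ} (ha : 0 < a) {G : Plane → ℝ}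
    (hG : IntegrableOn G (bigSquare s (m * a))) :
    ∫ x in bigSquare s (m * a), G x =
      ∑ i : Fin 2 → Fin m, ∫ x in bigSquare (tileVertex s a i) a, G x := by
  rw [← setIntegral_congr_set (cell_ae_eq_bigSquare s (m * a)), cell_eq_iUnion s ha,
    integral_iUnion_fintype (fun i => measurableSet_cell _ _) (pairwise_disjoint_cell_tile s m a)
      fun i => hG.mono_set ((cell_subset_bigSquare _ _).trans (cell_tile_subset s m a i))]
  exact Finset.sum_congr rfl fun i _ => setIntegral_congr_set (cell_ae_eq_bigSquare _ a)

/-! ### Rescaling to the unit square -/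

theorem chart_mem_unitSquare {s : Fin 2 → ℤ} {l : ℕ} (hl : 0 < l) {x : Plane} :
    chart s l x ∈ unitSquare ↔ x ∈ bigSquare s l := by
  have hl' : (0 : ℝ) < l := by exact_mod_cast hl
  rw [mem_bigSquare, unitSquare, mem_Icc, Pi.le_def, Pi.le_def, ← forall_and]
  refine forall_congr' fun c => ?_
  simp only [chart]
  constructor
  · rintro ⟨h1, h2⟩
    have h3 : 0 ≤ (x c - s c) / l := by linarith
    have h4 : (x c - s c) / l ≤ 1 := by linarith
    rw [div_le_one hl'] at h4
    have h5 : 0 ≤ x c - s c := by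
      rw [le_div_iff₀ hl', zero_mul] at h3
      exact h3
    constructor <;> linarith
  · rintro ⟨h1, h2⟩
    have h3 : 0 ≤ (x c - s c) / l := div_nonneg (by linarith) hl'.le
    have h4 : (x c - s c) / l ≤ 1 := (div_le_one hl').2 (by linarith)
    constructor <;> linarith

theorem dist_chart (s : Fin 2 → ℤ) (l : ℕ) (x y : Plane) :
    dist (chart s l x) (chart s l y) = dist x y / l := by
  have : chart s l = fun x : Plane => (l : ℝ)⁻¹ • x + (fun c => -(s c : ℝ) / l - 1 / 2) := by
    funext x c
    simp only [chart, Pi.add_apply, Pi.smul_apply, smul_eq_mul]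
    ring
  rw [this, dist_add_right, dist_smul₀, norm_inv, Real.norm_natCast, inv_mul_eq_div]

theorem continuous_chart (s : Fin 2 → ℤ) (l : ℕ) : Continuous (chart s l) := by
  unfold chart
  fun_prop

open Classical in
theorem setIntegral_bigSquare_comp_chart (s : Fin 2 → ℤ) {l : ℕ} (hl : 0 < l) (G : Plane → ℝ) :
    ∫ x in bigSquare s l, G (chart s l x) = (l : ℝ) ^ 2 * ∫ x in unitSquare, G x := by
  have hl' : (l : ℝ) ≠ 0 := by exact_mod_cast hl.ne'
  set v : Plane := fun c => -(s c : ℝ) / l - 1 / 2 with hv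
  have hc : ∀ x, chart s l x = (l : ℝ)⁻¹ • x + v := fun x => by
    funext c
    simp only [chart, hv, Pi.add_apply, Pi.smul_apply, smul_eq_mul]
    ring
  have h1 : (bigSquare s l).indicator (fun x => G (chart s l x)) =
      fun x => unitSquare.indicator G ((l : ℝ)⁻¹ • x + v) := by
    funext x
    rw [← hc, Set.indicator_apply, Set.indicator_apply]
    simp only [chart_mem_unitSquare hl]
  have hm1 : MeasurableSet (bigSquare s l) := measurableSet_Icc
  have hm2 : MeasurableSet unitSquare := measurableSet_Icc
  rw [← integral_indicator hm1, ← integral_indicator hm2, h1,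
    Measure.integral_comp_smul volume (fun x => unitSquare.indicator G (x + v)),
    integral_add_right_eq_self (fun x => unitSquare.indicator G x)]
  simp

theorem isCompact_unitSquare : IsCompact unitSquare := isCompact_Icc

/-! ### Equidistribution of `D` to the density `ρ` -/

/-- The error in the Riemann sum of a function over the points of `D` in a big square. -/
theorem abs_sum_sub_setIntegral_bigSquare_le {s : Fin 2 → ℤ} {m a : ℕ} (hm : 0 < m) (ha : 0 < a)
    {ρ h : Plane → ℝ} (hρ : ContinuousOn ρ unitSquare)
    (hρ_bd : ∀ x ∈ unitSquare, 0 ≤ ρ x ∧ ρ x ≤ 1) {D : Set Plane} (hD : D ⊆ lattice)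
    [DecidablePred fun z => toPlane z ∈ D]
    (hcard : ∀ i : Fin 2 → Fin m, (D ∩ smallSquare s (m * a) m i).ncard =
      ⌊∫ x in smallSquare s (m * a) m i, ρ (chart s (m * a) x)⌋₊)
    (hh : ContinuousOn h unitSquare) {M e : ℝ} (hM : ∀ x ∈ unitSquare, |h x| ≤ M)
    (he : ∀ x ∈ unitSquare, ∀ y ∈ unitSquare, dist x y ≤ 1 / m → |h x - h y| ≤ e) :
    |∑ z ∈ (cellPoints s (m * a)).filter (fun z => toPlane z ∈ D), h (chart s (m * a) (toPlane z)) -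
      ∫ x in bigSquare s (m * a), h (chart s (m * a) x) * ρ (chart s (m * a) x)| ≤
      (m : ℝ) ^ 2 * (2 * e * (a : ℝ) ^ 2 + M * (2 * a + 2)) := by
  have hl : 0 < m * a := Nat.mul_pos hm ha
  have hmaps : MapsTo (chart s (m * a)) (bigSquare s (m * a)) unitSquare := fun x hx =>
    (chart_mem_unitSquare hl).2 hx
  have hH := hh.comp (continuous_chart s (m * a)).continuousOn hmaps
  have hR := hρ.comp (continuous_chart s (m * a)).continuousOn hmaps
  have hHR : IntegrableOn (fun x => h (chart s (m * a) x) * ρ (chart s (m * a) x))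
      (bigSquare s (m * a)) := (hH.mul hR).integrableOn_compact (isCompact_bigSquare _ _)
  rw [sum_filter_cellPoints_eq s ha, setIntegral_bigSquare_eq_sum s ha hHR, ← Finset.sum_sub_distrib]
  have hconst : ∑ i : Fin 2 → Fin m, (2 * e * (a : ℝ) ^ 2 + M * (2 * a + 2)) =
      (m : ℝ) ^ 2 * (2 * e * (a : ℝ) ^ 2 + M * (2 * a + 2)) := by
    rw [Finset.sum_const, nsmul_eq_mul]
    simp
  rw [← hconst]
  refine (Finset.abs_sum_le_sum_abs _ _).trans (Finset.sum_le_sum fun i _ => ?_)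
  have hsub := cell_tile_subset s m a i
  refine abs_sum_sub_setIntegral_le (H := fun x => h (chart s (m * a) x))
    (R := fun x => ρ (chart s (m * a) x)) (Finset.filter_subset _ _) (hH.mono hsub) (hR.mono hsub)
    (fun x hx => (hρ_bd _ (hmaps (hsub hx))).1) (fun x hx => (hρ_bd _ (hmaps (hsub hx))).2)
    (fun x hx => hM _ (hmaps (hsub hx)))
    (fun x hx y hy => he _ (hmaps (hsub hx)) _ (hmaps (hsub hy)) ?_) ?_
  · rw [dist_chart]
    have hd : dist x y ≤ a := by
      refine (dist_pi_le_iff (Nat.cast_nonneg a)).2 fun c => ?_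
      have h1 := mem_bigSquare.1 hx c
      have h2 := mem_bigSquare.1 hy c
      rw [Real.dist_eq, abs_le]
      constructor <;> linarith
    have hm' : (0 : ℝ) < m := by exact_mod_cast hm
    have ha' : (0 : ℝ) < a := by exact_mod_cast ha
    push_cast
    rw [div_le_div_iff₀ (by positivity) hm']
    nlinarith
  -- The count error `2a + 2` is at most `2a + 1` points on the upper and right edges, plus one for
  -- the floor.
  · have hc := hcard i
    rw [smallSquare_eq_bigSquare s a hm i] at hc
    obtain ⟨h1, h2⟩ := card_filter_cellPoints_bounds hD (tileVertex s a i) a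
    have h0 : 0 ≤ ∫ x in bigSquare (tileVertex s a i) a, ρ (chart s (m * a) x) :=
      setIntegral_nonneg measurableSet_Icc fun x hx => (hρ_bd _ (hmaps (hsub hx))).1
    have h3 := Nat.floor_le h0
    have h4 := Nat.lt_floor_add_one (∫ x in bigSquare (tileVertex s a i) a, ρ (chart s (m * a) x))
    rw [← hc] at h3 h4
    have h1' : ((((cellPoints (tileVertex s a i) a).filter fun z => toPlane z ∈ D).card : ℕ) : ℝ) ≤
      ((D ∩ bigSquare (tileVertex s a i) a).ncard : ℝ) := by exact_mod_cast h1
    have h2' : ((D ∩ bigSquare (tileVertex s a i) a).ncard : ℝ) ≤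
      (((cellPoints (tileVertex s a i) a).filter fun z => toPlane z ∈ D).card : ℝ) + (2 * a + 1) := by
      exact_mod_cast h2
    rw [abs_le]
    constructor <;> linarith [(Nat.cast_nonneg a : (0 : ℝ) ≤ a)]

open Classical in
/-- The points of `D` in the half-open big squares equidistribute to the density `ρ`. -/
theorem tendsto_sum_densitySet {l m : ℕ → ℕ} {s : ℕ → Fin 2 → ℤ} (hS : IsSquareSystem l m s)
    {ρ : Plane → ℝ} (hρ : ContinuousOn ρ unitSquare)
    (hρ_bd : ∀ x ∈ unitSquare, 0 ≤ ρ x ∧ ρ x ≤ 1) {D : Set Plane} (hD : IsDensitySet l m s ρ D)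
    {h : Plane → ℝ} (hh : ContinuousOn h unitSquare) :
    Tendsto (fun n => (∑ z ∈ (cellPoints (s n) (l n)).filter (fun z => toPlane z ∈ D),
      h (chart (s n) (l n) (toPlane z))) / (l n : ℝ) ^ 2) atTop
      (𝓝 (∫ x in unitSquare, h x * ρ x)) := by
  obtain ⟨M, hM⟩ := isCompact_unitSquare.exists_bound_of_continuousOn hh
  have hM0 : 0 ≤ M := (norm_nonneg _).trans (hM 0 (by simp [unitSquare, Pi.le_def]))
  have huc := isCompact_unitSquare.uniformContinuousOn_of_continuous hh
  rw [Metric.uniformContinuousOn_iff] at huc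
  rw [Metric.tendsto_atTop]
  intro ε hε
  -- After division by `l²` the oscillation costs `2 · ε/8`, and the count error costs `M(2a + 2)/a²
  -- ≤ 4M/a < ε/2` once `a = l/m` exceeds `1` and `8M/ε`.
  obtain ⟨δ, hδ, hδ'⟩ := huc (ε / 8) (by positivity)
  have hev1 : ∀ᶠ n in atTop, 1 / δ < (m n : ℝ) :=
    (tendsto_natCast_atTop_atTop.comp hS.m_tendsto).eventually_gt_atTop _
  have hev2 : ∀ᶠ n in atTop, max 1 (8 * M / ε) < (l n : ℝ) / m n :=
    hS.ratio_tendsto.eventually_gt_atTop _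
  obtain ⟨n₀, hn₀⟩ := eventually_atTop.1 (hev1.and hev2)
  refine ⟨n₀, fun n hn => ?_⟩
  obtain ⟨h1, h2⟩ := hn₀ n hn
  obtain ⟨a, ha⟩ := hS.m_dvd_l n
  have hm := hS.m_pos n
  have hl := hS.l_pos n
  have hm' : (0 : ℝ) < m n := by exact_mod_cast hm
  have ha0 : 0 < a := Nat.pos_of_ne_zero fun h0 => by rw [ha, h0] at hl; simp at hl
  have ha' : (0 : ℝ) < a := by exact_mod_cast ha0
  have hra : (l n : ℝ) / m n = a := by rw [ha]; push_cast; field_simp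
  rw [hra, max_lt_iff] at h2
  have hmain := abs_sum_sub_setIntegral_bigSquare_le (e := ε / 8) hm ha0 hρ hρ_bd hD.subset_lattice
    (s := s n) (fun i => by have := hD.card_eq n i; rwa [ha] at this) hh hM (fun x hx y hy hxy => by
      have hlt : dist x y < δ := hxy.trans_lt (by
        rw [div_lt_iff₀ hm']; rw [div_lt_iff₀ hδ] at h1; linarith)
      exact (hδ' x hx y hy hlt).le)
  rw [← ha, setIntegral_bigSquare_comp_chart (s n) hl (fun x => h x * ρ x)] at hmain
  have hl' : (0 : ℝ) < (l n : ℝ) := by exact_mod_cast hl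
  rw [Real.dist_eq]
  have heq : ∀ A B : ℝ, A / (l n : ℝ) ^ 2 - B = (A - (l n : ℝ) ^ 2 * B) / (l n : ℝ) ^ 2 :=
    fun A B => by field_simp
  rw [heq, abs_div, abs_of_pos (by positivity : (0 : ℝ) < (l n : ℝ) ^ 2), div_lt_iff₀ (by positivity)]
  refine hmain.trans_lt ?_
  have hla : (l n : ℝ) = m n * a := by rw [ha]; push_cast; ring
  rw [hla, mul_pow, mul_left_comm]
  refine mul_lt_mul_of_pos_left ?_ (by positivity)
  have h3 : 8 * M < a * ε := by rw [← div_lt_iff₀ hε]; exact h2.2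
  have h4 : M * (2 * a + 2) ≤ M * (4 * a) := mul_le_mul_of_nonneg_left (by linarith [h2.1]) hM0
  nlinarith [mul_lt_mul_of_pos_right h3 ha', mul_pos hε (mul_pos ha' ha')]

/-! ### Locating preimages in the square -/

theorem mem_cell_of_ball_subset {s : Fin 2 → ℤ} {l : ℕ} (hl : 0 < l) {x : Plane} {δ : ℝ}
    (hδ : 0 < δ) (h : Metric.ball (chart s l x) δ ⊆ unitSquare) : x ∈ cell s l := by
  have hx := mem_bigSquare.1 ((chart_mem_unitSquare hl).1 (h (Metric.mem_ball_self hδ)))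
  -- Moving by `δ/2` in both coordinates stays in the unit square, which makes the upper
  -- inequalities strict.
  have hmem : chart s l x + (fun _ => δ / 2) ∈ unitSquare := by
    apply h
    rw [Metric.mem_ball, dist_eq_norm, add_sub_cancel_left]
    refine ((pi_norm_le_iff_of_nonneg (by positivity : (0 : ℝ) ≤ δ / 2)).2 fun c => ?_).trans_lt
      (by linarith : δ / 2 < δ)
    rw [Real.norm_of_nonneg (by positivity)]
  refine mem_cell.2 fun c => ⟨(hx c).1, ?_⟩
  have h2 := hmem.2 c
  have hl' : (0 : ℝ) < l := by exact_mod_cast hl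
  simp only [chart, Pi.add_apply] at h2
  have h3 : (x c - s c) / l < 1 := by linarith
  rw [div_lt_one hl'] at h3
  linarith

/-- Every point of a half-open big square is at distance at most `2` from a point of `D` in it. -/
theorem exists_mem_densitySet_dist_le {l m : ℕ → ℕ} {s : ℕ → Fin 2 → ℤ}
    (hS : IsSquareSystem l m s) {ρ : Plane → ℝ} {D : Set Plane} (hD : IsDensitySet l m s ρ D)
    (n : ℕ) {p : Plane} (hp : p ∈ cell (s n) (l n)) :
    ∃ u ∈ D ∩ bigSquare (s n) (l n), dist u p ≤ 2 := by
  -- Rounding down to an even offset from the vertex stays in the half-open square; as the vertex is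
  -- even, `u` lies in `2ℤ × ℤ`, all of whose points in the tiles belong to `D`.
  set u : Fin 2 → ℤ := fun c => s n c + 2 * ⌊(p c - s n c) / 2⌋ with hu
  have hp' := mem_cell.1 hp
  have hle (c : Fin 2) : (u c : ℝ) ≤ p c := by
    have := Int.floor_le ((p c - s n c) / 2)
    simp only [hu]
    push_cast
    linarith
  have hge (c : Fin 2) : p c < u c + 2 := by
    have := Int.lt_floor_add_one ((p c - s n c) / 2)
    simp only [hu]
    push_cast
    linarith
  have hcell : toPlane u ∈ cell (s n) (l n) := by
    refine mem_cell.2 fun c => ⟨?_, (hle c).trans_lt (hp' c).2⟩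
    have : 0 ≤ ⌊(p c - s n c) / 2⌋ := Int.floor_nonneg.2 (by linarith [(hp' c).1])
    simp only [toPlane, hu]
    norm_cast
    omega
  refine ⟨toPlane u, ⟨?_, cell_subset_bigSquare _ _ hcell⟩, ?_⟩
  · obtain ⟨a, ha⟩ := hS.m_dvd_l n
    have ha0 : 0 < a := Nat.pos_of_ne_zero fun h0 => by
      have hl := hS.l_pos n
      rw [ha, h0] at hl
      simp at hl
    have hcell' := hcell
    rw [ha] at hcell'
    obtain ⟨i, hi⟩ := exists_mem_cell_tile ha0 hcell'
    refine hD.evenFirst_subset n i ⟨?_, toPlane_mem_lattice u, ?_⟩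
    · rw [ha, smallSquare_eq_bigSquare _ _ (hS.m_pos n)]
      exact cell_subset_bigSquare _ _ hi
    · obtain ⟨t, ht⟩ := hS.vertex_even n 0
      refine ⟨t + ⌊(p 0 - s n 0) / 2⌋, ?_⟩
      simp only [toPlane, hu, ht]
      push_cast
      ring
  · refine (dist_pi_le_iff zero_le_two).2 fun c => ?_
    have := hle c
    have := hge c
    rw [Real.dist_eq, abs_le]
    simp only [toPlane]
    constructor <;> linarith

/-- If a point of `D` is sent by the normalized map to `F q`, where `F` is close to the normalized
map, then it is close to `q`. -/
theorem dist_chart_le_of_normalized_eq {l m : ℕ → ℕ} {s : ℕ → Fin 2 → ℤ}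
    (hS : IsSquareSystem l m s) {ρ : Plane → ℝ} {D : Set Plane} (hD : IsDensitySet l m s ρ D)
    {L : ℝ≥0} {K : ℝ} (hK : 0 ≤ K) {f : Plane → Plane}
    (hco : ∀ x ∈ D, ∀ y ∈ D, dist x y ≤ K * dist (f x) (f y)) (n : ℕ)
    {fhat : Plane → Plane} {b q w x : Plane} {ε : ℝ} (hlip : LipschitzOnWith L fhat unitSquare)
    (heq : ∀ u ∈ D ∩ bigSquare (s n) (l n), fhat (chart (s n) (l n) u) = (1 / (l n : ℝ)) • (f u - b))
    (hq : q ∈ unitSquare) (hqc : chartInv (s n) (l n) q ∈ cell (s n) (l n))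
    (hε : dist w (fhat q) ≤ ε) (hx : x ∈ D) (hxw : (1 / (l n : ℝ)) • (f x - b) = w) :
    dist (chart (s n) (l n) x) q ≤ (K * (2 * L) + 2) / l n + K * ε := by
  have hl := hS.l_pos n
  have hl' : (0 : ℝ) < l n := by exact_mod_cast hl
  obtain ⟨u, hu, hup⟩ := exists_mem_densitySet_dist_le hS hD n hqc
  have h1 : dist (chart (s n) (l n) u) q ≤ 2 / l n := by
    have := dist_chart (s n) (l n) u (chartInv (s n) (l n) q)
    rw [chart_chartInv _ hl] at this
    rw [this]
    gcongr
  have h2 : dist (fhat (chart (s n) (l n) u)) (fhat q) ≤ L * (2 / l n) :=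
    (hlip.dist_le_mul _ ((chart_mem_unitSquare hl).2 hu.2) _ hq).trans
      (mul_le_mul_of_nonneg_left h1 L.2)
  have h3 : dist (f x) (f u) / l n ≤ ε + L * (2 / l n) := by
    have h4 : dist ((1 / (l n : ℝ)) • (f x - b)) ((1 / (l n : ℝ)) • (f u - b)) =
        dist (f x) (f u) / l n := by
      rw [dist_smul₀, dist_sub_right, norm_div, norm_one, Real.norm_natCast]
      ring
    rw [← h4, hxw, ← heq u hu]
    refine (dist_triangle _ (fhat q) _).trans (add_le_add hε ?_)
    rwa [dist_comm]
  have h5 : dist (chart (s n) (l n) x) (chart (s n) (l n) u) ≤ K * (ε + L * (2 / l n)) := by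
    rw [dist_chart]
    refine le_trans ?_ (mul_le_mul_of_nonneg_left h3 hK)
    rw [← mul_div_assoc]
    gcongr
    exact hco x hx u hu.1
  refine (dist_triangle _ (chart (s n) (l n) u) _).trans ((add_le_add h5 h1).trans (le_of_eq ?_))
  ring

/-! ### Passage to the limit against a test function -/

/-- Only points where `ψ` is nonzero count, so `g` need be a bijection from `P` to `T` only over
them. Here `T` will be the scaled lattice in a ball and `g` the normalized map. -/
theorem tsum_subtype_eq_sum_comp {ι α : Type*} {P : Finset ι} {g : ι → α}
    (hg : InjOn g P) {T : Set α} {ψ : α → ℝ} (h1 : ∀ z ∈ P, ψ (g z) ≠ 0 → g z ∈ T)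
    (h2 : ∀ p ∈ T, ψ p ≠ 0 → ∃ z ∈ P, g z = p) :
    ∑' x : T, ψ x = ∑ z ∈ P, ψ (g z) := by
  classical
  rw [tsum_subtype T ψ, tsum_eq_sum (s := P.image g), Finset.sum_image hg]
  · refine Finset.sum_congr rfl fun z hz => ?_
    rw [Set.indicator_apply]
    split_ifs with h
    · rfl
    · by_contra hne
      exact h (h1 z hz fun h0 => hne h0.symm)
  · intro p hp
    rw [Set.indicator_apply_eq_zero]
    intro hpT
    by_contra hne
    obtain ⟨z, hz, rfl⟩ := h2 p hpT hne
    exact hp (Finset.mem_image_of_mem g hz)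

open scoped Pointwise in
theorem mem_smul_span_iff {l : ℕ} {p : Plane} :
    p ∈ (l : ℝ)⁻¹ • (Submodule.span ℤ (range (Pi.basisFun ℝ (Fin 2))) : Set Plane) ↔
      ∃ v ∈ lattice, (1 / (l : ℝ)) • v = p := by
  have h : ∀ v : Plane, v ∈ (Submodule.span ℤ (range (Pi.basisFun ℝ (Fin 2))) : Set Plane) ↔
      v ∈ lattice := fun v => by
    rw [SetLike.mem_coe, Module.Basis.mem_span_iff_repr_mem ℤ (Pi.basisFun ℝ (Fin 2)) v]
    simp only [Pi.basisFun_repr, mem_range, algebraMap_int_eq, eq_intCast, lattice, mem_ofPred_eq,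
      eq_comm]
  rw [Set.mem_smul_set, one_div]
  simp only [h]

open Classical in
open scoped Pointwise in
/-- A uniform limit of maps that are eventually injective and onto over the support of `ψ`
transports the density `ρ` to the Lebesgue measure, tested against `ψ`. -/
theorem setIntegral_comp_mul_eq_integral
    {l m : ℕ → ℕ} {s : ℕ → Fin 2 → ℤ} (hS : IsSquareSystem l m s)
    {ρ : Plane → ℝ} (hρ : ContinuousOn ρ unitSquare)
    (hρ_bd : ∀ x ∈ unitSquare, 0 ≤ ρ x ∧ ρ x ≤ 1) {D : Set Plane} (hD : IsDensitySet l m s ρ D)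
    {L : ℝ≥0} {ω : ℝ → ℝ} (hω : IsModulus ω) {f : Plane → Plane}
    (hf_bij : BijOn f D lattice) (hf_co : IsCoUniform ω D f)
    {F : Plane → Plane} (hF : IsRenormalizedLimit l s D f L F) (hFc : ContinuousOn F unitSquare)
    {W : Set Plane} (hWF : W ⊆ F '' unitSquare) (hV : IsOpen (unitSquare ∩ F ⁻¹' W))
    {ψ : Plane → ℝ} (hψ : Continuous ψ) (hψc : HasCompactSupport ψ) (hψW : tsupport ψ ⊆ W) :
    ∫ x in unitSquare, ψ (F x) * ρ x = ∫ x, ψ x := by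
  obtain ⟨x₀, fhat, σ, hx₀, hlip, heqOn, hσ, hunif⟩ := hF
  have hlpos : ∀ n, (0 : ℝ) < l n := fun n => by exact_mod_cast hS.l_pos n
  have hltop : Tendsto (fun k => (l (σ k) : ℝ)) atTop atTop :=
    (tendsto_natCast_atTop_atTop.comp hS.l_tendsto).comp hσ.tendsto_atTop
  have hbase : ∀ n, chartInv (s n) (l n) (x₀ n) ∈ D := fun n => by
    obtain ⟨u, hu, hux⟩ := hx₀ n
    rw [← hux, chartInv_chart _ (hS.l_pos n)]
    exact hu.1
  have hval : ∀ n, ∀ u ∈ D ∩ bigSquare (s n) (l n), fhat n (chart (s n) (l n) u) =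
      (1 / (l n : ℝ)) • (f u - f (chartInv (s n) (l n) (x₀ n))) := fun n u hu => by
    rw [heqOn n ⟨u, hu, rfl⟩, normalizedMap, chartInv_chart _ (hS.l_pos n)]
  set P : ℕ → Finset (Fin 2 → ℤ) := fun n =>
    (cellPoints (s n) (l n)).filter fun z => toPlane z ∈ D with hP
  have hPmem : ∀ n, ∀ z ∈ P n, toPlane z ∈ D ∩ bigSquare (s n) (l n) := fun n z hz => by
    rw [hP, Finset.mem_filter] at hz
    exact ⟨hz.2, cell_subset_bigSquare _ _ (toPlane_mem_cell.2 hz.1)⟩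
  have hA : Tendsto (fun k => (∑ z ∈ P (σ k), ψ (F (chart (s (σ k)) (l (σ k)) (toPlane z)))) /
      (l (σ k) : ℝ) ^ 2) atTop (𝓝 (∫ x in unitSquare, ψ (F x) * ρ x)) :=
    (tendsto_sum_densitySet hS hρ hρ_bd hD (hψ.comp_continuousOn hFc)).comp hσ.tendsto_atTop
  have hAB : Tendsto (fun k => (∑ z ∈ P (σ k), ψ (F (chart (s (σ k)) (l (σ k)) (toPlane z)))) /
      (l (σ k) : ℝ) ^ 2 - (∑ z ∈ P (σ k), ψ (fhat (σ k) (chart (s (σ k)) (l (σ k)) (toPlane z)))) /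
      (l (σ k) : ℝ) ^ 2) atTop (𝓝 0) := by
    have huc := hψc.uniformContinuous_of_continuous hψ
    rw [Metric.uniformContinuous_iff] at huc
    rw [Metric.tendsto_atTop]
    intro ε hε
    obtain ⟨δ, hδ, hδ'⟩ := huc (ε / 2) (by positivity)
    obtain ⟨k₀, hk₀⟩ := eventually_atTop.1 (Metric.tendstoUniformlyOn_iff.1 hunif δ hδ)
    refine ⟨k₀, fun k hk => ?_⟩
    have hl2 : (0 : ℝ) < (l (σ k) : ℝ) ^ 2 := pow_pos (hlpos _) 2
    rw [Real.dist_eq, sub_zero, ← sub_div, abs_div, abs_of_pos hl2, div_lt_iff₀ hl2,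
      ← Finset.sum_sub_distrib]
    calc _ ≤ ∑ z ∈ P (σ k), |ψ (F (chart (s (σ k)) (l (σ k)) (toPlane z))) -
          ψ (fhat (σ k) (chart (s (σ k)) (l (σ k)) (toPlane z)))| :=
          Finset.abs_sum_le_sum_abs _ _
      _ ≤ ∑ z ∈ P (σ k), ε / 2 := Finset.sum_le_sum fun z hz =>
          (hδ' (hk₀ k hk _ ((chart_mem_unitSquare (hS.l_pos _)).2 (hPmem _ z hz).2))).le
      _ = (P (σ k)).card * (ε / 2) := by rw [Finset.sum_const, nsmul_eq_mul]
      _ ≤ (l (σ k) : ℝ) ^ 2 * (ε / 2) := by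
          have := Finset.card_le_card
            (Finset.filter_subset (fun z => toPlane z ∈ D) (cellPoints (s (σ k)) (l (σ k))))
          rw [card_cellPoints] at this
          exact mul_le_mul_of_nonneg_right (by exact_mod_cast this) (by positivity)
      _ < ε * (l (σ k) : ℝ) ^ 2 := by nlinarith
  have hB := hA.sub hAB
  simp only [sub_sub_cancel, sub_zero] at hB
  obtain ⟨r, hr⟩ := hψc.isBounded.subset_closedBall (0 : Plane)
  have hC : Tendsto (fun k => (∑' x : ↑(Metric.closedBall (0 : Plane) r ∩ (l (σ k) : ℝ)⁻¹ •
      (Submodule.span ℤ (range (Pi.basisFun ℝ (Fin 2))) : Set Plane)), ψ x) /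
      (l (σ k) : ℝ) ^ Fintype.card (Fin 2)) atTop (𝓝 (∫ x in Metric.closedBall 0 r, ψ x)) :=
    ((tendsto_tsum_div_pow_atTop_integral (Metric.closedBall (0 : Plane) r) ψ hψ
      Metric.isBounded_closedBall measurableSet_closedBall
      ((convex_closedBall (0 : Plane) r).addHaar_frontier volume)).comp hS.l_tendsto).comp
      hσ.tendsto_atTop
  rw [setIntegral_eq_integral_of_forall_compl_eq_zero
    fun x hx => image_eq_zero_of_notMem_tsupport fun h => hx (hr h)] at hC
  -- It remains to see that the sum over `D` and the lattice sum are eventually equal, not merely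
  -- close.
  refine tendsto_nhds_unique (hB.congr' ?_) hC
  have hK : 0 ≤ ω 2 := (hω.pos 2 two_pos).le
  have hA' : IsCompact (unitSquare ∩ F ⁻¹' tsupport ψ) :=
    isCompact_unitSquare.of_isClosed_subset
      (hFc.preimage_isClosed_of_isClosed isCompact_unitSquare.isClosed (isClosed_tsupport ψ))
      inter_subset_left
  -- Openness of the preimage of `W` in the plane gives a margin `δ` between the compact set of
  -- relevant `q` and the boundary of the unit square.
  obtain ⟨δ, hδ, hδV⟩ := hA'.exists_thickening_subset_open hV
    (inter_subset_inter_right _ (preimage_mono hψW))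
  have hball : ∀ q ∈ unitSquare ∩ F ⁻¹' tsupport ψ, Metric.ball q δ ⊆ unitSquare := fun q hq =>
    (Metric.ball_subset_thickening hq δ).trans (hδV.trans inter_subset_left)
  set η : ℝ := δ / (8 * (ω 2 + 1)) with hη
  have hη0 : 0 < η := by positivity
  have hKη : ω 2 * η ≤ δ / 8 := by
    rw [hη, ← mul_div_assoc, div_le_div_iff₀ (by positivity) (by norm_num)]
    nlinarith
  have hsmall : ∀ᶠ k in atTop, (ω 2 * (2 * L) + 2) / (l (σ k) : ℝ) < δ / 8 :=
    (hltop.const_div_atTop _).eventually_lt_const (by positivity)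
  filter_upwards [hsmall, Metric.tendstoUniformlyOn_iff.1 hunif η hη0] with k hk1 hk2
  have hl := hS.l_pos (σ k)
  set b := f (chartInv (s (σ k)) (l (σ k)) (x₀ (σ k))) with hb
  -- The base value is an integer point, so translating by it preserves `ℤ²` in both directions.
  have hbl : b ∈ lattice := hf_bij.mapsTo (hbase (σ k))
  have hgz : ∀ z ∈ P (σ k), fhat (σ k) (chart (s (σ k)) (l (σ k)) (toPlane z)) =
      (1 / (l (σ k) : ℝ)) • (f (toPlane z) - b) := fun z hz => hval _ _ (hPmem _ z hz)
  rw [Fintype.card_fin, tsum_subtype_eq_sum_comp (P := P (σ k))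
    (g := fun z => fhat (σ k) (chart (s (σ k)) (l (σ k)) (toPlane z)))]
  · intro z hz w hw hzw
    simp only [hgz z hz, hgz w hw] at hzw
    have hne : (1 / (l (σ k) : ℝ)) ≠ 0 := (one_div_pos.2 (hlpos _)).ne'
    have := sub_left_injective (smul_right_injective Plane hne hzw)
    exact toPlane_injective (hf_bij.injOn (hPmem _ z hz).1 (hPmem _ w hw).1 this)
  · intro z hz hne
    refine ⟨hr (subset_tsupport ψ hne), mem_smul_span_iff.2 ⟨f (toPlane z) - b, ?_, (hgz z hz).symm⟩⟩
    intro c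
    obtain ⟨i, hi⟩ := hf_bij.mapsTo (hPmem _ z hz).1 c
    obtain ⟨j, hj⟩ := hbl c
    exact ⟨i - j, by rw [Pi.sub_apply, hi, hj]; push_cast; ring⟩
  · rintro p ⟨-, hp⟩ hne
    obtain ⟨v, hv, rfl⟩ := mem_smul_span_iff.1 hp
    have hpt := subset_tsupport ψ hne
    obtain ⟨q, hq, hqp⟩ := hWF (hψW hpt)
    have hvb : v + b ∈ lattice := fun c => by
      obtain ⟨i, hi⟩ := hv c
      obtain ⟨j, hj⟩ := hbl c
      exact ⟨i + j, by rw [Pi.add_apply, hi, hj]; push_cast; ring⟩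
    -- A priori `x` may lie anywhere in `D`. The estimate `hd` puts its image under the chart within
    -- `δ/8 + δ/8` of `q`, so a ball of radius `δ/2` around that image still fits in the unit
    -- square.
    obtain ⟨x, hx, hxv⟩ := hf_bij.surjOn hvb
    have hqA : q ∈ unitSquare ∩ F ⁻¹' tsupport ψ := ⟨hq, by rw [mem_preimage, hqp]; exact hpt⟩
    have hqc : chartInv (s (σ k)) (l (σ k)) q ∈ cell (s (σ k)) (l (σ k)) :=
      mem_cell_of_ball_subset hl hδ (by rw [chart_chartInv _ hl]; exact hball q hqA)
    have hxw : (1 / (l (σ k) : ℝ)) • (f x - b) = F q := by rw [hxv, add_sub_cancel_right, hqp]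
    have hd := dist_chart_le_of_normalized_eq hS hD hK
      (fun x hx y hy => hf_co.dist_le hω hf_bij hx hy) (σ k) (hlip (σ k)) (hval (σ k)) hq hqc
      (hk2 q hq).le hx hxw
    have hxc : x ∈ cell (s (σ k)) (l (σ k)) := by
      refine mem_cell_of_ball_subset hl (half_pos hδ)
        ((Metric.ball_subset_ball' ?_).trans (hball q hqA))
      linarith
    obtain ⟨z, rfl⟩ := exists_toPlane_of_mem_lattice (hD.subset_lattice hx)
    have hzP : z ∈ P (σ k) := Finset.mem_filter.2 ⟨toPlane_mem_cell.1 hxc, hx⟩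
    exact ⟨z, hzP, by simp only [hgz z hzP]; rw [hxw, hqp]⟩

/-! ### From test functions to measures -/

theorem integral_densityMeasure {ρ : Plane → ℝ} (hρ : ContinuousOn ρ unitSquare)
    (hρ0 : ∀ x ∈ unitSquare, 0 ≤ ρ x) (h : Plane → ℝ) :
    ∫ x, h x ∂(densityMeasure ρ) = ∫ x in unitSquare, h x * ρ x := by
  have hm : MeasurableSet unitSquare := measurableSet_Icc
  rw [densityMeasure, integral_withDensity_eq_integral_toReal_smul₀
    (hρ.aemeasurable hm).ennreal_ofReal (by simp)]
  refine setIntegral_congr_fun hm fun x hx => ?_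
  simp only [smul_eq_mul]
  rw [ENNReal.toReal_ofReal (hρ0 x hx), mul_comm]

theorem isFiniteMeasure_densityMeasure {ρ : Plane → ℝ} (hρ : ContinuousOn ρ unitSquare) :
    IsFiniteMeasure (densityMeasure ρ) :=
  isFiniteMeasure_withDensity_ofReal
    (hρ.integrableOn_compact isCompact_unitSquare : Integrable ρ _).2

/-- Two measures that agree on continuous functions with compact support in an open set `W` agree
on the compact subsets of `W`. -/
theorem restrict_eq_restrict_of_integral_eq {X : Type*} [MetricSpace X] [ProperSpace X]
    [MeasurableSpace X] [BorelSpace X] {μ ν : Measure X} [IsFiniteMeasureOnCompacts μ]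
    [IsFiniteMeasureOnCompacts ν] {W Q : Set X} (hW : IsOpen W) (hQ : IsCompact Q) (hQW : Q ⊆ W)
    (h : ∀ ψ : X → ℝ, Continuous ψ → HasCompactSupport ψ → tsupport ψ ⊆ W →
      ∫ x, ψ x ∂μ = ∫ x, ψ x ∂ν) :
    μ.restrict Q = ν.restrict Q := by
  obtain ⟨K, hK, hQK, hKW⟩ := exists_compact_between hQ hW hQW
  -- Weighting both measures by a cutoff `χ` equal to one on `Q` makes them finite without changing
  -- them on `Q`. For bounded continuous `g`, the product `χ * g` is then an admissible test
  -- function.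
  obtain ⟨χ, hχ1, hχ0, hχc, hχ⟩ := exists_continuous_one_zero_of_isCompact hQ
    (isOpen_interior (s := K)).isClosed_compl (disjoint_compl_right_iff_subset.2 hQK)
  have hsupp : tsupport χ ⊆ K := closure_minimal (fun x hx => by
    by_contra hxK
    exact hx (hχ0 fun h' => hxK (interior_subset h'))) hK.isClosed
  have hfin : ∀ (τ : Measure X) [IsFiniteMeasureOnCompacts τ],
      IsFiniteMeasure (τ.withDensity fun x => ENNReal.ofReal (χ x)) := fun τ _ =>
    isFiniteMeasure_withDensity_ofReal (χ.continuous.integrable_of_hasCompactSupport hχc).2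
  have hint : ∀ (τ : Measure X) (g : X → ℝ),
      ∫ x, g x ∂(τ.withDensity fun x => ENNReal.ofReal (χ x)) = ∫ x, χ x * g x ∂τ := fun τ g => by
    rw [integral_withDensity_eq_integral_toReal_smul
      (f := fun x => ENNReal.ofReal (χ x))
      χ.continuous.measurable.ennreal_ofReal (by simp)]
    refine integral_congr_ae (Eventually.of_forall fun x => ?_)
    simp only [smul_eq_mul]
    rw [ENNReal.toReal_ofReal (hχ x).1]
  have hres : ∀ τ : Measure X,
      (τ.withDensity fun x => ENNReal.ofReal (χ x)).restrict Q = τ.restrict Q := fun τ => by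
    rw [restrict_withDensity hQ.measurableSet]
    conv_rhs => rw [← withDensity_one (μ := τ.restrict Q)]
    refine withDensity_congr_ae ?_
    filter_upwards [ae_restrict_mem hQ.measurableSet] with x hx
    simp [hχ1 hx]
  have := hfin μ
  have := hfin ν
  rw [← hres μ, ← hres ν]
  congr 1
  refine ext_of_forall_integral_eq_of_IsFiniteMeasure fun g => ?_
  rw [hint, hint]
  refine h _ (χ.continuous.mul g.continuous) hχc.mul_right ?_
  exact (tsupport_mul_subset_left.trans hsupp).trans hKW

end DeloneRenorm

theorem mainTheorem2
    (l m : ℕ → ℕ) (s : ℕ → Fin 2 → ℤ) (hS : DeloneRenorm.IsSquareSystem l m s)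
    (ρ : DeloneRenorm.Plane → ℝ) (hρ : ContinuousOn ρ DeloneRenorm.unitSquare)
    (hρ_bd : ∀ x ∈ DeloneRenorm.unitSquare, 8 / 9 ≤ ρ x ∧ ρ x ≤ 1)
    (D : Set DeloneRenorm.Plane) (hD : DeloneRenorm.IsDensitySet l m s ρ D)
    (L : ℝ≥0) (ω : ℝ → ℝ) (hω : DeloneRenorm.IsModulus ω)
    (hω_o : ω =o[atTop] fun r : ℝ => r ^ 2)
    (f : DeloneRenorm.Plane → DeloneRenorm.Plane)
    (hf_bij : BijOn f D DeloneRenorm.lattice) (hf_lip : LipschitzOnWith L f D)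
    (hf_co : DeloneRenorm.IsCoUniform ω D f)
    (F : DeloneRenorm.Plane → DeloneRenorm.Plane)
    (hF : DeloneRenorm.IsRenormalizedLimit l s D f L F)
    (W : Set DeloneRenorm.Plane) (hW : DeloneRenorm.DecomposesOver F W)
    (k : ℕ) (y : DeloneRenorm.Plane) (hy : y ∈ DeloneRenorm.scaledLattice (l k))
    (r : ℝ) (hr : 0 < r) (hQ : Metric.closedBall y r ⊆ W) :
    ((DeloneRenorm.densityMeasure ρ).map F).restrict (Metric.closedBall y r) =
      (volume : Measure DeloneRenorm.Plane).restrict (Metric.closedBall y r) := by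
  have hρ_bd' : ∀ x ∈ DeloneRenorm.unitSquare, 0 ≤ ρ x ∧ ρ x ≤ 1 := fun x hx =>
    ⟨by linarith [(hρ_bd x hx).1], (hρ_bd x hx).2⟩
  obtain ⟨hWo, hWF, N, V, hVo, -, -, hVu, -⟩ := hW
  -- The decomposition enters through this openness in the plane, not merely relative to the unit
  -- square.
  have hV : IsOpen (DeloneRenorm.unitSquare ∩ F ⁻¹' W) := hVu ▸ isOpen_iUnion hVo
  have hFc : ContinuousOn F DeloneRenorm.unitSquare := by
    obtain ⟨x₀, fhat, σ, -, hlip, -, -, hunif⟩ := hF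
    exact hunif.continuousOn (Frequently.of_forall fun n => (hlip (σ n)).continuousOn)
  have hFm : AEMeasurable F (DeloneRenorm.densityMeasure ρ) :=
    (hFc.aemeasurable measurableSet_Icc).mono_ac (withDensity_absolutelyContinuous _ _)
  have := DeloneRenorm.isFiniteMeasure_densityMeasure hρ
  refine DeloneRenorm.restrict_eq_restrict_of_integral_eq hWo (isCompact_closedBall y r) hQ
    fun ψ hψ hψc hψW => ?_
  rw [integral_map hFm hψ.aestronglyMeasurable,
    DeloneRenorm.integral_densityMeasure hρ fun x hx => (hρ_bd' x hx).1]
  exact DeloneRenorm.setIntegral_comp_mul_eq_integral hS hρ hρ_bd' hD hω hf_bij hf_co hF hFc hWF hV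
    hψ hψc hψW
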